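/- Let $G=(V,E)$ be a finite simple unweighted undirected graph with Laplacian $L=D-A$, and let $L^+$ be the Moore–Penrose pseudoinverse of $L$. The effective resistance of two vertices $u,v$ in the same connected component is $\mathcal R(u,v)=(\mathbf 1_u-\mathbf 1_v)^{T}L^{+}(\mathbf 1_u-\mathbf 1_v)$, and $\mathcal R(u,v)=\infty$ if $u$ and $v$ lie in different components. The ER density of $G$ is $\rho(G)=\max_{v\in V}\,|\{u\in V:\mathcal R(v,u)\le 1\}|$ (and $0$ if $V=\emptyset$). A tree decomposition of $G$ is a finite tree $T$ with a bag $B_i\subseteq V$ for each node $i$ such that the bags cover $V$, each edge has both its endpoints in a common bag, and $B_i\cap B_k\subseteq B_j$ whenever $j$ is on the path from $i$ to $k$ in $T$; the treewidth of $G$ is the least $k\ge 0$ such that $G$ has a tree decomposition all of whose bags have at most $k+1$ vertices. Theorem. There is an absolute constant $C$ such that every finite graph $G$ with maximum degree $d$ and treewidth $w$ satisfies $$\rho(G)\le \max\{2,\,wd\}^{\,C\,w d^{3}};$$ in particular, $\rho(G)\le (wd)^{C w d^3}$, that is, $\rho(G) = (wd)^{O(wd^3)}$, whenever $d\ge 2$.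 Consequently, graphs of bounded maximum degree and bounded treewidth have constant ER density: for all $d_0,w_0\in\mathbb N$ there is a $K$ such that $\rho(G)\le K$ for every finite graph $G$ with maximum degree at most $d_0$ and treewidth at most $w_0$. -/

import Mathlib

universe u

section Pseudoinverse

open Matrix

/-- `P` is the (Moore–Penrose) pseudoinverse of the real matrix `A`. -/
structure IsPseudoinverse {m n : Type*} [Fintype m] [Fintype n]
    (A : Matrix m n ℝ) (P : Matrix n m ℝ) : Prop where
  mul_mul_self : A * P * A = A
  self_mul_mul : P * A * P = P
  symm_left : (A * P)ᵀ = A * P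
  symm_right : (P * A)ᵀ = P * A

theorem IsPseudoinverse.eq {m n : Type*} [Fintype m] [Fintype n]
    {A : Matrix m n ℝ} {P Q : Matrix n m ℝ}
    (hP : IsPseudoinverse A P) (hQ : IsPseudoinverse A Q) : P = Q := by
  have h1 : A * P = A * Q := by
    calc A * P = (A * P)ᵀ := hP.symm_left.symm
      _ = ((A * Q) * (A * P))ᵀ := by
          rw [← Matrix.mul_assoc, hQ.mul_mul_self]
      _ = (A * P) * (A * Q) := by
          rw [transpose_mul, hP.symm_left, hQ.symm_left]
      _ = A * Q := by rw [← Matrix.mul_assoc, hP.mul_mul_self]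
  have h2 : P * A = Q * A := by
    calc P * A = (P * A)ᵀ := hP.symm_right.symm
      _ = ((P * A) * (Q * A))ᵀ := by
          rw [Matrix.mul_assoc, ← Matrix.mul_assoc A, hQ.mul_mul_self]
      _ = (Q * A) * (P * A) := by
          rw [transpose_mul, hP.symm_right, hQ.symm_right]
      _ = Q * A := by rw [Matrix.mul_assoc, ← Matrix.mul_assoc A, hP.mul_mul_self]
  calc P = P * (A * P) := by rw [← Matrix.mul_assoc, hP.self_mul_mul]
    _ = Q * A * Q := by rw [h1, ← Matrix.mul_assoc, h2]
    _ = Q := hQ.self_mul_mul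

/-- Every real symmetric matrix has a pseudoinverse. -/
theorem Matrix.IsHermitian.exists_isPseudoinverse {n : Type*} [Fintype n] [DecidableEq n]
    {A : Matrix n n ℝ} (hA : A.IsHermitian) : ∃ P : Matrix n n ℝ, IsPseudoinverse A P := by
  obtain ⟨U, d, hU, hAd⟩ : ∃ (U : Matrix n n ℝ) (d : n → ℝ),
      Uᵀ * U = 1 ∧ A = U * diagonal d * Uᵀ := by
    refine ⟨hA.eigenvectorUnitary, hA.eigenvalues, ?_, ?_⟩
    · simpa [star_eq_conjTranspose] using Unitary.coe_star_mul_self hA.eigenvectorUnitary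
    · have h := hA.spectral_theorem
      rw [Unitary.conjStarAlgAut_apply] at h
      simpa [star_eq_conjTranspose, Function.comp_def] using h
  have key : ∀ a b : n → ℝ, (U * diagonal a * Uᵀ) * (U * diagonal b * Uᵀ)
      = U * diagonal (fun i => a i * b i) * Uᵀ := by
    intro a b
    rw [← diagonal_mul_diagonal]
    calc (U * diagonal a * Uᵀ) * (U * diagonal b * Uᵀ)
        = U * diagonal a * (Uᵀ * U) * diagonal b * Uᵀ := by simp only [Matrix.mul_assoc]
      _ = _ := by rw [hU, Matrix.mul_one]; simp only [Matrix.mul_assoc]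
  have tr : ∀ a : n → ℝ, (U * diagonal a * Uᵀ)ᵀ = U * diagonal a * Uᵀ := by
    intro a
    simp [transpose_mul, Matrix.mul_assoc]
  refine ⟨U * diagonal (fun i => (d i)⁻¹) * Uᵀ, ?_, ?_, ?_, ?_⟩
  · rw [hAd, key, key]; congr 3; funext i; exact mul_inv_mul_cancel (d i)
  · rw [hAd, key, key]; congr 3; funext i
    simpa using mul_inv_mul_cancel (d i)⁻¹
  · rw [hAd, key, tr]
  · rw [hAd, key, tr]

end Pseudoinverse

namespace SimpleGraph

section EffectiveResistance

open Matrix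

theorem exists_isPseudoinverse_lapMatrix {V : Type u} [Fintype V] [DecidableEq V]
    (G : SimpleGraph V) [DecidableRel G.Adj] :
    ∃ P : Matrix V V ℝ, IsPseudoinverse (G.lapMatrix ℝ) P :=
  Matrix.IsHermitian.exists_isPseudoinverse (by
    rw [Matrix.IsHermitian, Matrix.conjTranspose_eq_transpose_of_trivial]
    exact G.isSymm_lapMatrix (R := ℝ))

/-- The pseudoinverse `L⁺` of the graph Laplacian `L = D - A`. -/
noncomputable def lapPinv {V : Type u} [Fintype V] [DecidableEq V]
    (G : SimpleGraph V) [DecidableRel G.Adj] : Matrix V V ℝ :=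
  (exists_isPseudoinverse_lapMatrix G).choose

theorem isPseudoinverse_lapPinv {V : Type u} [Fintype V] [DecidableEq V]
    (G : SimpleGraph V) [DecidableRel G.Adj] : IsPseudoinverse (G.lapMatrix ℝ) G.lapPinv :=
  (exists_isPseudoinverse_lapMatrix G).choose_spec

open Classical in
/-- The effective resistance `(1_u - 1_v)ᵀ L⁺ (1_u - 1_v)` between two vertices of an unweighted
graph (every edge has resistance one); it is infinite between different components. -/
noncomputable def effRes {V : Type u} [Fintype V] [DecidableEq V]
    (G : SimpleGraph V) [DecidableRel G.Adj] (a b : V) : EReal :=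
  if G.Reachable a b then
    (((Pi.single a 1 - Pi.single b 1 : V → ℝ) ⬝ᵥ
      (G.lapPinv *ᵥ (Pi.single a 1 - Pi.single b 1 : V → ℝ)) : ℝ) : EReal)
  else ⊤

/-- The closed unit ball around `v` with respect to effective resistance. -/
def erBall {V : Type u} [Fintype V] [DecidableEq V]
    (G : SimpleGraph V) [DecidableRel G.Adj] (v : V) : Set V :=
  {a | G.effRes v a ≤ 1}

/-- The ER density: the maximum size of a unit ball of effective resistance. -/
noncomputable def erDensity {V : Type u} [Fintype V] [DecidableEq V]
    (G : SimpleGraph V) [DecidableRel G.Adj] : ℕ :=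
  Finset.univ.sup fun v : V => (G.erBall v).ncard

end EffectiveResistance

section Treewidth

/-- A tree decomposition of `G`, with nodes `ι` and a bag of vertices for every node. -/
structure TreeDecomposition {V : Type u} (G : SimpleGraph V) (ι : Type*) where
  tree : SimpleGraph ι
  isTree : tree.IsTree
  bag : ι → Finset V
  vertex_covered : ∀ v : V, ∃ i, v ∈ bag i
  edge_covered : ∀ v w : V, G.Adj v w → ∃ i, v ∈ bag i ∧ w ∈ bag i
  path_condition : ∀ (i k : ι) (p : tree.Walk i k), p.IsPath → ∀ j ∈ p.support,
    ∀ v : V, v ∈ bag i → v ∈ bag k → v ∈ bag j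

/-- The treewidth of `G`: the least `k` for which `G` has a finite tree decomposition all of
whose bags have at most `k + 1` vertices. -/
noncomputable def treewidth {V : Type u} (G : SimpleGraph V) : ℕ :=
  sInf {k : ℕ | ∃ (n : ℕ) (D : TreeDecomposition G (Fin n)), ∀ i, (D.bag i).card ≤ k + 1}

/-- For a finite graph the infimum that defines the treewidth is attained. -/
theorem exists_treeDecomposition_card_le_treewidth {V : Type u} [Fintype V]
    (G : SimpleGraph V) :
    ∃ (n : ℕ) (D : TreeDecomposition G (Fin n)), ∀ i, (D.bag i).card ≤ G.treewidth + 1 := by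
  refine Nat.sInf_mem (s := {k : ℕ | ∃ (n : ℕ) (D : TreeDecomposition G (Fin n)),
    ∀ i, (D.bag i).card ≤ k + 1}) ⟨Fintype.card V, 1, ?_⟩
  exact ⟨{ tree := ⊥
           isTree := IsTree.of_subsingleton
           bag := fun _ => Finset.univ
           vertex_covered := fun v => ⟨0, Finset.mem_univ v⟩
           edge_covered := fun v w _ => ⟨0, Finset.mem_univ v, Finset.mem_univ w⟩
           path_condition := fun _ _ _ _ _ _ v _ _ => Finset.mem_univ v },
    fun _ => Nat.le_succ_of_le (Finset.card_le_univ _)⟩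

end Treewidth

end SimpleGraph

/-! Fix `v`, and let `w` be the treewidth and `d` the maximum degree, both positive. A tree
partition whose root bag contains `v` and whose bags have size at most `p = 24(w+1)d` exists by
`exists_isTreePartition_of_separators`: the prescribed root set is repeatedly cut by balanced
separators, which are bags of a tree decomposition. If `u` lies at depth `K`, let the potential of a
vertex count the non-root nodes its branch shares with the branch to `u`. It is 0 at `v` and `K` at
`u`, and changes, by 1, only along edges from one of the `K` bags on that branch to the parent bag,
so its Dirichlet energy is at most `Kpd`. When the effective resistance is at most 1, the energy
bounds the squared potential difference (`sq_sub_le_of_effRes_le_one`), so `K² ≤ Kpd` and `K ≤ pd`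
(`IsTreePartition.length_le`). The component of `v` meets at most `(pd)^i` bags at depth `i`
(`IsTreePartition.card_addressesAt_le`), so the unit ball has at most `(pd+1)(pd)^(pd) p` vertices,
where `pd = 24(w+1)d²`. -/

namespace SimpleGraph

/-! ### Balanced separators from tree decompositions. -/

section Sep

/-- A finite family of weights, each at most half of `M`, of total at most `M`, splits into two
parts of weight at most two thirds of `M`. -/
theorem _root_.Finset.exists_subset_sum_le_two_thirds {ι : Type*} [DecidableEq ι] (s : Finset ι)
    (a : ι → ℕ) (M : ℕ) (hM : ∑ i ∈ s, a i ≤ M) (ha : ∀ i ∈ s, 2 * a i ≤ M) :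
    ∃ J ⊆ s, 3 * ∑ i ∈ J, a i ≤ 2 * M ∧ 3 * ∑ i ∈ s \ J, a i ≤ 2 * M := by
  by_cases h : ∃ i ∈ s, M ≤ 3 * a i
  · obtain ⟨i, hi, hMi⟩ := h
    refine ⟨{i}, by simpa using hi, ?_, ?_⟩
    · have := ha i hi
      simp only [Finset.sum_singleton]; omega
    · have := Finset.sum_sdiff (f := a) (Finset.singleton_subset_iff.2 hi)
      simp only [Finset.sum_singleton] at this; omega
  · push Not at h
    -- All weights are now below `M/3`. If one more weight overflows a maximal `J`, then `J` already
    -- exceeds `M/3`, so its complement is below `2M/3`.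
    obtain ⟨J, hJ, hmax⟩ := Finset.exists_max_image
      (s.powerset.filter fun J => 3 * ∑ i ∈ J, a i ≤ 2 * M) Finset.card
      ⟨∅, by simp⟩
    simp only [Finset.mem_filter, Finset.mem_powerset] at hJ hmax
    refine ⟨J, hJ.1, hJ.2, ?_⟩
    have hsum := Finset.sum_sdiff (f := a) hJ.1
    by_cases hs : (s \ J).Nonempty
    · obtain ⟨i, hi⟩ := hs
      rw [Finset.mem_sdiff] at hi
      have h1 := h i hi.1
      by_contra hcon
      have h2 := hmax (insert i J) ⟨Finset.insert_subset hi.1 hJ.1, by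
        rw [Finset.sum_insert hi.2]; omega⟩
      rw [Finset.card_insert_of_notMem hi.2] at h2
      omega
    · rw [Finset.not_nonempty_iff_eq_empty.1 hs]; simp

variable {ι : Type*} {T : SimpleGraph ι}

/-- The path between two vertices of a tree. -/
noncomputable def IsTree.path (hT : T.IsTree) (i j : ι) : T.Walk i j :=
  (hT.existsUnique_path i j).choose

theorem IsTree.isPath_path (hT : T.IsTree) (i j : ι) : (hT.path i j).IsPath :=
  (hT.existsUnique_path i j).choose_spec.1

theorem IsTree.eq_path (hT : T.IsTree) {i j : ι} {p : T.Walk i j} (hp : p.IsPath) :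
    p = hT.path i j :=
  (hT.existsUnique_path i j).choose_spec.2 p hp

/-- The branch at `t` containing `i` is encoded by the second vertex of the path from `t` to `i`. -/
theorem IsTree.snd_path_eq (hT : T.IsTree) {t s i : ι} (h : T.Adj t s) (q : T.Walk s i)
    (hq : t ∉ q.support) : (hT.path t i).snd = s := by
  classical
  have hp : (Walk.cons h q.bypass).IsPath := by
    rw [Walk.cons_isPath_iff]
    exact ⟨q.bypass_isPath, fun hmem => hq (q.support_bypass_subset_support hmem)⟩
  rw [← hT.eq_path hp]
  simp

theorem IsTree.exists_walk_snd_path (hT : T.IsTree) {t i : ι} (h : t ≠ i) :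
    ∃ s, (hT.path t i).snd = s ∧ T.Adj t s ∧ ∃ q : T.Walk s i, q.IsPath ∧ t ∉ q.support := by
  have hp := hT.isPath_path t i
  generalize hT.path t i = p at hp
  cases p with
  | nil => exact absurd rfl h
  | cons hadj q =>
    rw [Walk.cons_isPath_iff] at hp
    exact ⟨_, by simp, hadj, q, hp⟩

theorem IsTree.snd_path_eq_of_walk (hT : T.IsTree) {t i j : ι} (q : T.Walk i j)
    (hq : t ∉ q.support) : (hT.path t i).snd = (hT.path t j).snd := by
  have hti : t ≠ i := fun h => hq (h ▸ q.start_mem_support)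
  obtain ⟨s, rfl, hadj, r, -, hr⟩ := hT.exists_walk_snd_path hti
  refine (hT.snd_path_eq hadj (r.append q) ?_).symm
  rw [Walk.mem_support_append_iff]
  tauto

theorem IsTree.not_snd_path_swap (hT : T.IsTree) {t s i : ι} (ht : t ≠ i)
    (h1 : (hT.path t i).snd = s) (h2 : (hT.path s i).snd = t) : False := by
  obtain ⟨s', hs', -, q, hqp, hq⟩ := hT.exists_walk_snd_path ht
  obtain rfl := h1.symm.trans hs'
  apply hq
  rw [hT.eq_path hqp]
  have := (hT.path s i).getVert_mem_support 1
  rwa [show (hT.path s i).getVert 1 = t from h2] at this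

/-- A self-map of a finite tree that moves every vertex to a neighbour swaps two vertices. -/
theorem IsTree.exists_swap [Finite ι] (hT : T.IsTree) (f : ι → ι) (hf : ∀ t, T.Adj t (f t)) :
    ∃ t, f (f t) = t := by
  classical
  have := Fintype.ofFinite ι
  have hcard := hT.card_edgeFinset
  -- A tree has fewer edges than vertices, so two vertices choose the same edge.
  obtain ⟨x, -, y, -, hxy, he⟩ := Finset.exists_ne_map_eq_of_card_lt_of_maps_to
    (s := (Finset.univ : Finset ι)) (t := T.edgeFinset) (f := fun t => s(t, f t))
    (by rw [Finset.card_univ]; omega) (fun t _ => by simpa using hf t)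
  rw [Sym2.eq_iff] at he
  rcases he with ⟨h, -⟩ | ⟨h, h'⟩
  · exact absurd h hxy
  · exact ⟨x, by rw [h', ← h]⟩

variable {V : Type*} [Fintype V] [DecidableEq V] {G : SimpleGraph V} {n : ℕ}

open Classical in
/-- Some bag of a tree decomposition leaves, in each branch of the tree at its node, at most half
of a prescribed vertex set. -/
theorem TreeDecomposition.exists_branches (D : TreeDecomposition G (Fin n)) (W : Finset V) :
    ∃ (t : Fin n) (c : V → Fin n),
      (∀ x y, x ∉ D.bag t → y ∉ D.bag t → G.Adj x y → c x = c y) ∧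
      ∀ s, 2 * (W.filter fun x => x ∉ D.bag t ∧ c x = s).card ≤ W.card := by
  choose loc hloc using D.vertex_covered
  have hT := D.isTree
  have hne : ∀ t x, x ∉ D.bag t → t ≠ loc x := fun t x hx h => hx (h ▸ hloc x)
  -- The bags containing `x` all lie in one branch at `t`, since a path between two of them through
  -- `t` would put `x` in the bag of `t`.
  have key : ∀ t x i, x ∉ D.bag t → x ∈ D.bag i →
      (hT.path t (loc x)).snd = (hT.path t i).snd := fun t x i hx hi =>
    hT.snd_path_eq_of_walk (hT.path (loc x) i) fun hmem =>
      hx (D.path_condition _ _ _ (hT.isPath_path _ _) t hmem x (hloc x) hi)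
  by_contra! hcon
  have hcon' : ∀ t, ∃ s, W.card <
      2 * (W.filter fun x => x ∉ D.bag t ∧ (hT.path t (loc x)).snd = s).card := fun t =>
    hcon t (fun x => (hT.path t (loc x)).snd) fun x y hx hy hxy => by
      obtain ⟨i, hxi, hyi⟩ := D.edge_covered x y hxy
      rw [key t x i hx hxi, key t y i hy hyi]
  -- Each node points to a branch holding more than half of `W`. Two adjacent nodes point at each
  -- other, and the vertex sets counted there are disjoint, which is too much.
  choose f hf using hcon'
  have hadj : ∀ t, D.tree.Adj t (f t) := by
    intro t
    have hpos : 0 < (W.filter fun x => x ∉ D.bag t ∧ (hT.path t (loc x)).snd = f t).card := by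
      have := hf t; omega
    obtain ⟨x, hx⟩ := Finset.card_pos.1 hpos
    rw [Finset.mem_filter] at hx
    obtain ⟨s, hs, hadj, -⟩ := hT.exists_walk_snd_path (hne t x hx.2.1)
    rwa [← hx.2.2, hs]
  obtain ⟨t, ht⟩ := hT.exists_swap f hadj
  have h1 := hf t
  have h2 := hf (f t)
  rw [ht] at h2
  have hdisj : Disjoint (W.filter fun x => x ∉ D.bag t ∧ (hT.path t (loc x)).snd = f t)
      (W.filter fun x => x ∉ D.bag (f t) ∧ (hT.path (f t) (loc x)).snd = t) := by
    rw [Finset.disjoint_left]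
    intro x hx hx'
    rw [Finset.mem_filter] at hx hx'
    exact hT.not_snd_path_swap (hne _ _ hx.2.1) hx.2.2 hx'.2.2
  have h3 := Finset.card_le_card (Finset.union_subset
    (Finset.filter_subset (fun x => x ∉ D.bag t ∧ (hT.path t (loc x)).snd = f t) W)
    (Finset.filter_subset (fun x => x ∉ D.bag (f t) ∧ (hT.path (f t) (loc x)).snd = t) W))
  rw [Finset.card_union_of_disjoint hdisj] at h3
  omega

/-- `X` is a separator of `G` with sides `A` and `B`, each containing at most two thirds of `W`. -/
structure IsBalancedSeparation (G : SimpleGraph V) (W X A B : Finset V) : Prop where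
  mem_or : ∀ x, x ∈ X ∨ x ∈ A ∨ x ∈ B
  disjoint : Disjoint A B
  disjoint_left : Disjoint X A
  disjoint_right : Disjoint X B
  not_adj : ∀ x ∈ A, ∀ y ∈ B, ¬ G.Adj x y
  card_left : 3 * (W ∩ A).card ≤ 2 * W.card
  card_right : 3 * (W ∩ B).card ≤ 2 * W.card

theorem TreeDecomposition.exists_isBalancedSeparation (D : TreeDecomposition G (Fin n))
    (W : Finset V) : ∃ t A B, G.IsBalancedSeparation W (D.bag t) A B := by
  classical
  obtain ⟨t, c, hc, hW⟩ := D.exists_branches W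
  have hsum : ∀ J : Finset (Fin n),
      ∑ s ∈ J, (W.filter fun x => x ∉ D.bag t ∧ c x = s).card =
        (W.filter fun x => x ∉ D.bag t ∧ c x ∈ J).card := by
    intro J
    rw [Finset.card_eq_sum_card_fiberwise (f := c) (t := J)]
    · refine Finset.sum_congr rfl fun s hs => ?_
      rw [Finset.filter_filter]
      congr 1
      refine Finset.filter_congr fun x _ => ?_
      constructor
      · rintro ⟨h1, rfl⟩; exact ⟨⟨h1, hs⟩, rfl⟩
      · rintro ⟨⟨h1, -⟩, h2⟩; exact ⟨h1, h2⟩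
    · intro x hx
      simp only [Finset.coe_filter, Set.mem_ofPred_eq] at hx
      exact hx.2.2
  obtain ⟨J, -, hJ1, hJ2⟩ := Finset.exists_subset_sum_le_two_thirds Finset.univ
    (fun s => (W.filter fun x => x ∉ D.bag t ∧ c x = s).card) W.card
    (by rw [hsum]; exact Finset.card_filter_le _ _) (fun s _ => hW s)
  rw [hsum] at hJ1
  refine ⟨t, Finset.univ.filter fun x => x ∉ D.bag t ∧ c x ∈ J,
    Finset.univ.filter fun x => x ∉ D.bag t ∧ c x ∉ J, ?_, ?_, ?_, ?_, ?_, ?_, ?_⟩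
  · intro x; simp only [Finset.mem_filter, Finset.mem_univ, true_and]; tauto
  · rw [Finset.disjoint_left]; intro x; simp only [Finset.mem_filter]; tauto
  · rw [Finset.disjoint_left]; intro x; simp only [Finset.mem_filter]; tauto
  · rw [Finset.disjoint_left]; intro x; simp only [Finset.mem_filter]; tauto
  · intro x hx y hy hxy
    simp only [Finset.mem_filter, Finset.mem_univ, true_and] at hx hy
    exact hy.2 (hc x y hx.1 hy.1 hxy ▸ hx.2)
  · convert hJ1 using 3
    ext x; simp
  · have hJc : ∑ s ∈ Finset.univ \ J, (W.filter fun x => x ∉ D.bag t ∧ c x = s).card =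
        (W ∩ Finset.univ.filter fun x => x ∉ D.bag t ∧ c x ∉ J).card := by
      rw [hsum]; congr 1; ext x; simp
    rwa [hJc] at hJ2

end Sep
end SimpleGraph

namespace SimpleGraph

/-! ### Effective resistance and Dirichlet energy. -/

section Energy

open Matrix

variable {V : Type*} [Fintype V] [DecidableEq V] {G : SimpleGraph V} [DecidableRel G.Adj]

theorem dotProduct_single_sub_single (f : V → ℝ) (a b : V) :
    f ⬝ᵥ (Pi.single a 1 - Pi.single b 1 : V → ℝ) = f a - f b := by
  simp [dotProduct_sub]

/-- The error `y = e - LL⁺e` lies in the kernel of `L`, hence is constant on components. It is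
therefore orthogonal both to `e` and to the range of `L`, so to itself. -/
theorem lapMatrix_mulVec_lapPinv {a b : V} (h : G.Reachable a b) :
    G.lapMatrix ℝ *ᵥ (G.lapPinv *ᵥ (Pi.single a 1 - Pi.single b 1 : V → ℝ)) =
      Pi.single a 1 - Pi.single b 1 := by
  have hP := isPseudoinverse_lapPinv G
  have hL : (G.lapMatrix ℝ)ᵀ = G.lapMatrix ℝ := G.isSymm_lapMatrix (R := ℝ)
  set L := G.lapMatrix ℝ
  set P := G.lapPinv
  set e : V → ℝ := Pi.single a 1 - Pi.single b 1 with he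
  have hLLP : L * (L * P) = L := by
    rw [← hP.symm_left, transpose_mul, hL, ← Matrix.mul_assoc]
    have := congrArg transpose hP.mul_mul_self
    rwa [transpose_mul, transpose_mul, hL, ← Matrix.mul_assoc] at this
  set y := e - L *ᵥ (P *ᵥ e) with hy
  have hLy : L *ᵥ y = 0 := by
    rw [hy, mulVec_sub, mulVec_mulVec, mulVec_mulVec, Matrix.mul_assoc, hLLP, sub_self]
  have hyab : y ⬝ᵥ e = 0 := by
    rw [he, dotProduct_single_sub_single, sub_eq_zero]
    exact (lapMatrix_mulVec_eq_zero_iff_forall_reachable G).1 hLy a b h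
  have hyy : y ⬝ᵥ y = 0 := by
    have h2 : y ⬝ᵥ (L *ᵥ (P *ᵥ e)) = 0 := by
      rw [dotProduct_mulVec, ← mulVec_transpose, hL, hLy, zero_dotProduct]
    conv_lhs => rw [hy, dotProduct_sub]
    rw [← hy, hyab, h2, sub_self]
  exact (sub_eq_zero.1 (dotProduct_self_eq_zero.1 hyy)).symm

theorem reachable_of_effRes_le_one {a b : V} (h : G.effRes a b ≤ 1) : G.Reachable a b := by
  by_contra hn
  rw [effRes, if_neg hn, top_le_iff] at h
  exact absurd h (EReal.coe_ne_top 1)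

/-- The Dirichlet energy bounds the squared difference of a potential at two vertices whose
effective resistance is at most one. -/
theorem sq_sub_le_of_effRes_le_one {a b : V} (h : G.effRes a b ≤ 1) (f : V → ℝ) :
    (f a - f b) ^ 2 ≤ (∑ i, ∑ j, if G.Adj i j then (f i - f j) ^ 2 else 0) / 2 := by
  have hreach := reachable_of_effRes_le_one h
  rw [effRes, if_pos hreach] at h
  have hR : (Pi.single a 1 - Pi.single b 1 : V → ℝ) ⬝ᵥ
      (G.lapPinv *ᵥ (Pi.single a 1 - Pi.single b 1 : V → ℝ)) ≤ 1 := by exact_mod_cast h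
  have hLx := lapMatrix_mulVec_lapPinv hreach
  have hsymm : ∀ u v : V → ℝ, u ⬝ᵥ (G.lapMatrix ℝ *ᵥ v) = v ⬝ᵥ (G.lapMatrix ℝ *ᵥ u) := by
    intro u v
    rw [dotProduct_mulVec, ← mulVec_transpose, (G.isSymm_lapMatrix (R := ℝ)).eq, dotProduct_comm]
  rw [← lapMatrix_toLinearMap₂', Matrix.toLinearMap₂'_apply']
  set x := G.lapPinv *ᵥ (Pi.single a 1 - Pi.single b 1 : V → ℝ)
  set t := f a - f b with ht
  have hft : f ⬝ᵥ (G.lapMatrix ℝ *ᵥ x) = t := by rw [hLx, dotProduct_single_sub_single]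
  have hxx : x ⬝ᵥ (G.lapMatrix ℝ *ᵥ x) ≤ 1 := by rwa [hLx, dotProduct_comm]
  -- Cauchy–Schwarz for the Laplacian form: expanding gives energy at least `2t² - t²R`, where `R ≤
  -- 1` is the effective resistance.
  have hpos : 0 ≤ (f - t • x) ⬝ᵥ (G.lapMatrix ℝ *ᵥ (f - t • x)) := by
    rw [← Matrix.toLinearMap₂'_apply', lapMatrix_toLinearMap₂']
    refine div_nonneg (Finset.sum_nonneg fun i _ => Finset.sum_nonneg fun j _ => ?_) zero_le_two
    split_ifs <;> positivity
  simp only [mulVec_sub, mulVec_smul, dotProduct_sub, sub_dotProduct, smul_dotProduct,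
    dotProduct_smul, smul_eq_mul, hsymm x f, hft] at hpos
  nlinarith [sq_nonneg t]

end Energy
end SimpleGraph

namespace SimpleGraph

/-! ### Tree partitions with small bags. -/

section TreePartition

variable {V : Type*} {G : SimpleGraph V}

/-- A partition of `S` into bags indexed by the nodes of a rooted tree, so that every edge lies in
one bag or joins the bags of a node and of its parent. A node is given by its address (a list whose
tail is the address of the parent). -/
def IsTreePartition (G : SimpleGraph V) (S : Finset V) (π : V → List ℕ) : Prop :=
  ∀ x ∈ S, ∀ y ∈ S, G.Adj x y → π x = π y ∨ (∃ a, π x = a :: π y) ∨ ∃ a, π y = a :: π x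

theorem IsTreePartition.map {S : Finset V} {π : V → List ℕ} (hπ : G.IsTreePartition S π)
    (f : ℕ → ℕ) : G.IsTreePartition S fun x => (π x).map f := by
  intro x hx y hy hxy
  rcases hπ x hx y hy hxy with h | ⟨a, h⟩ | ⟨a, h⟩
  · exact Or.inl (by simp only [h])
  · exact Or.inr (Or.inl ⟨f a, by simp [h]⟩)
  · exact Or.inr (Or.inr ⟨f a, by simp [h]⟩)

variable [DecidableEq V]

/-- Addresses end at the root, so appending `0` hangs the old tree below a new root with bag `R`. -/
theorem IsTreePartition.cons_bag {S R R' : Finset V} {π : V → List ℕ}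
    (hπ : G.IsTreePartition (S \ R) π) (hR' : ∀ x ∈ R', π x = [])
    (hN : ∀ x ∈ R, ∀ y ∈ S \ R, G.Adj x y → y ∈ R') :
    G.IsTreePartition S fun x => if x ∈ R then [] else π x ++ [0] := by
  intro x hx y hy hxy
  by_cases hxR : x ∈ R <;> by_cases hyR : y ∈ R <;> simp only [hxR, hyR, if_true, if_false]
  · exact Or.inl trivial
  · have := hR' y (hN x hxR y (Finset.mem_sdiff.2 ⟨hy, hyR⟩) hxy)
    exact Or.inr (Or.inr ⟨0, by simp [this]⟩)
  · have := hR' x (hN y hyR x (Finset.mem_sdiff.2 ⟨hx, hxR⟩) hxy.symm)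
    exact Or.inr (Or.inl ⟨0, by simp [this]⟩)
  · rcases hπ x (Finset.mem_sdiff.2 ⟨hx, hxR⟩) y (Finset.mem_sdiff.2 ⟨hy, hyR⟩) hxy with
      h | ⟨a, h⟩ | ⟨a, h⟩
    · exact Or.inl (by rw [h])
    · exact Or.inr (Or.inl ⟨a, by rw [h]; rfl⟩)
    · exact Or.inr (Or.inr ⟨a, by rw [h]; rfl⟩)

theorem card_filter_cons_bag_le {S R : Finset V} {π : V → List ℕ} {p : ℕ}
    (hR : R.card ≤ p) (hp : ∀ l, ((S \ R).filter fun x => π x = l).card ≤ p) (l : List ℕ) :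
    (S.filter fun x => (if x ∈ R then [] else π x ++ [0]) = l).card ≤ p := by
  by_cases hl : l = []
  · refine (Finset.card_le_card fun x hx => ?_).trans hR
    rw [Finset.mem_filter, hl] at hx
    by_contra h
    simp [h] at hx
  · refine (Finset.card_le_card fun x hx => ?_).trans (hp l.dropLast)
    rw [Finset.mem_filter] at hx
    by_cases h : x ∈ R
    · simp only [h, if_true] at hx
      exact absurd hx.2.symm hl
    · simp only [h, if_false] at hx
      simp [← hx.2, hx.1, h]

/-- Two tree partitions with a common part of the root bags, glueAddressd at the root. -/
def glueAddress (B : Finset V) (π₁ π₂ : V → List ℕ) (x : V) : List ℕ :=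
  if x ∈ B then (π₂ x).map (fun a => 2 * a + 1) else (π₁ x).map (fun a => 2 * a)

/-- An edge leaving `B` ends in the separator, whose vertices have the empty address on both sides;
every other edge stays within one of the two partitions. -/
theorem IsTreePartition.glue {S X A B : Finset V} {π₁ π₂ : V → List ℕ}
    (hmem : ∀ x, x ∈ X ∨ x ∈ A ∨ x ∈ B) (hAB : ∀ x ∈ A, ∀ y ∈ B, ¬ G.Adj x y)
    (hXA : Disjoint X A)
    (hdAB : Disjoint A B)
    (h₁ : G.IsTreePartition (S \ B) π₁) (h₂ : G.IsTreePartition (S \ A) π₂)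
    (hX₁ : ∀ x ∈ X ∩ S, π₁ x = []) (hX₂ : ∀ x ∈ X ∩ S, π₂ x = []) :
    G.IsTreePartition S (glueAddress B π₁ π₂) := by
  have hB : ∀ x ∈ S, x ∈ B → x ∈ S \ A := fun x hx hxB =>
    Finset.mem_sdiff.2 ⟨hx, fun h => Finset.disjoint_left.1 hdAB h hxB⟩
  have hX : ∀ x ∈ S, x ∉ B → (∃ y ∈ B, G.Adj x y) →
      x ∈ S \ A ∧ glueAddress B π₁ π₂ x = (π₂ x).map (fun a => 2 * a + 1) := by
    rintro x hx hxB ⟨y, hy, hxy⟩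
    have hxX : x ∈ X := by
      rcases hmem x with h | h | h
      · exact h
      · exact absurd hxy (hAB x h y hy)
      · exact absurd h hxB
    refine ⟨Finset.mem_sdiff.2 ⟨hx, Finset.disjoint_left.1 hXA hxX⟩, ?_⟩
    have hxXS := Finset.mem_inter.2 ⟨hxX, hx⟩
    simp [glueAddress, hxB, hX₁ x hxXS, hX₂ x hxXS]
  intro x hx y hy hxy
  by_cases hxB : x ∈ B <;> by_cases hyB : y ∈ B
  · have := h₂.map (fun a => 2 * a + 1) x (hB x hx hxB) y (hB y hy hyB) hxy
    simpa only [glueAddress, hxB, hyB, if_true] using this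
  · obtain ⟨hy', hyg⟩ := hX y hy hyB ⟨x, hxB, hxy.symm⟩
    have := h₂.map (fun a => 2 * a + 1) x (hB x hx hxB) y hy' hxy
    rw [hyg]
    simpa only [glueAddress, hxB, if_true] using this
  · obtain ⟨hx', hxg⟩ := hX x hx hxB ⟨y, hyB, hxy⟩
    have := h₂.map (fun a => 2 * a + 1) x hx' y (hB y hy hyB) hxy
    rw [hxg]
    simpa only [glueAddress, hyB, if_true] using this
  · have := h₁.map (fun a => 2 * a) x (Finset.mem_sdiff.2 ⟨hx, hxB⟩) y
      (Finset.mem_sdiff.2 ⟨hy, hyB⟩) hxy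
    simpa only [glueAddress, hxB, hyB, if_false] using this

theorem card_filter_glue_nil_le {S A B : Finset V} (hdAB : Disjoint A B) (π₁ π₂ : V → List ℕ) :
    (S.filter fun x => glueAddress B π₁ π₂ x = []).card ≤
      ((S \ B).filter fun x => π₁ x = []).card + ((S \ A).filter fun x => π₂ x = []).card := by
  refine (Finset.card_le_card fun x hx => ?_).trans (Finset.card_union_le _ _)
  rw [Finset.mem_filter] at hx
  by_cases h : x ∈ B
  · have := fun h' => Finset.disjoint_left.1 hdAB h' h
    simp_all [glueAddress]
  · simp_all [glueAddress]

theorem card_filter_glue_le {S A B : Finset V} (hdAB : Disjoint A B) {π₁ π₂ : V → List ℕ} {p : ℕ}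
    (h₁ : ∀ l, ((S \ B).filter fun x => π₁ x = l).card ≤ p)
    (h₂ : ∀ l, ((S \ A).filter fun x => π₂ x = l).card ≤ p) (a : ℕ) (l : List ℕ) :
    (S.filter fun x => glueAddress B π₁ π₂ x = a :: l).card ≤ p := by
  have hev : ∀ l : List ℕ, (l.map fun a => 2 * a).map (· / 2) = l := fun l => by
    rw [List.map_map]; convert List.map_id l using 2; funext b; simp
  have hod : ∀ l : List ℕ, (l.map fun a => 2 * a + 1).map (· / 2) = l := fun l => by
    rw [List.map_map]; convert List.map_id l using 2; funext b
    simp only [Function.comp_apply, id]; omega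
  -- The parity of a label tells which side it comes from, so only the root bags merge.
  rcases Nat.even_or_odd a with ha | ha
  · refine (Finset.card_le_card fun x hx => ?_).trans (h₁ ((a :: l).map (· / 2)))
    rw [Finset.mem_filter, glueAddress] at hx
    rw [Finset.mem_filter, Finset.mem_sdiff]
    obtain ⟨hxS, hx⟩ := hx
    split_ifs at hx with h
    · obtain ⟨b, c, -, hb, -⟩ := List.map_eq_cons_iff.1 hx
      rw [← hb] at ha
      exact absurd ha (by simp)
    · exact ⟨⟨hxS, h⟩, by rw [← hx, hev]⟩
  · refine (Finset.card_le_card fun x hx => ?_).trans (h₂ ((a :: l).map (· / 2)))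
    rw [Finset.mem_filter, glueAddress] at hx
    rw [Finset.mem_filter, Finset.mem_sdiff]
    obtain ⟨hxS, hx⟩ := hx
    split_ifs at hx with h
    · exact ⟨⟨hxS, fun h' => Finset.disjoint_left.1 hdAB h' h⟩, by rw [← hx, hod]⟩
    · obtain ⟨b, c, -, hb, -⟩ := List.map_eq_cons_iff.1 hx
      rw [← hb] at ha
      exact absurd ha (by simp)

/-- A graph of maximum degree at most `d` whose vertex sets have balanced separators of size `k`
has a tree partition into bags of size at most `24 k d`, with a prescribed set in the root bag. -/
theorem exists_isTreePartition_of_separators [Fintype V] [DecidableRel G.Adj] {k d : ℕ} (hk : 1 ≤ k)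
    (hd : 1 ≤ d) (hdeg : ∀ x, G.degree x ≤ d)
    (hsep : ∀ W : Finset V, ∃ X A B, X.card ≤ k ∧ G.IsBalancedSeparation W X A B)
    (S R : Finset V) (hRS : R ⊆ S) (hne : R.Nonempty) (hR : R.card ≤ 12 * k * d) :
    ∃ π : V → List ℕ, G.IsTreePartition S π ∧ (∀ x ∈ R, π x = []) ∧
      ((S.filter fun x => π x = []).card ≤ R.card ∨
        (S.filter fun x => π x = []).card + 4 * k ≤ 2 * R.card) ∧
      ∀ l, (S.filter fun x => π x = l).card ≤ 24 * k * d := by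
  -- The slack `4k` in the root bound pays for the separator, which is counted on both sides of a
  -- split. Nonemptiness of `R` makes `S` shrink in the unsplit case.
  induction hn : S.card using Nat.strong_induction_on generalizing S R with
  | _ n ih =>
  subst hn
  have hkd : k ≤ k * d := Nat.le_mul_of_pos_right k hd
  by_cases hsmall : R.card ≤ 12 * k
  · -- the root bag is `R`
    by_cases hSR : (S \ R).Nonempty
    · obtain ⟨z, hz⟩ := hSR
      set N := R.biUnion (fun x => G.neighborFinset x) ∩ (S \ R) with hN
      have hNcard : N.card ≤ 12 * k * d :=
        (Finset.card_le_card Finset.inter_subset_left).trans <|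
          (Finset.card_biUnion_le_card_mul R _ d fun x _ => hdeg x).trans
            (Nat.mul_le_mul_right d hsmall)
      obtain ⟨R', hNR', hR'S, hR'ne, hR'card⟩ : ∃ R', N ⊆ R' ∧ R' ⊆ S \ R ∧ R'.Nonempty ∧
          R'.card ≤ 12 * k * d := by
        rcases N.eq_empty_or_nonempty with h | h
        · refine ⟨{z}, by simp [h], by simpa using hz, by simp, ?_⟩
          simp only [Finset.card_singleton]; nlinarith
        · exact ⟨N, subset_rfl, Finset.inter_subset_right, h, hNcard⟩
      obtain ⟨π, hπ, hroot, -, hbag⟩ := ih (S \ R).card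
        (Finset.card_lt_card (Finset.sdiff_ssubset hRS hne)) (S \ R) R' hR'S hR'ne hR'card rfl
      refine ⟨fun x => if x ∈ R then [] else π x ++ [0], hπ.cons_bag hroot ?_, ?_, Or.inl ?_, ?_⟩
      · intro x hx y hy hxy
        exact hNR' (Finset.mem_inter.2 ⟨Finset.mem_biUnion.2 ⟨x, hx, by simpa using hxy⟩, hy⟩)
      · intro x hx; simp [hx]
      · refine Finset.card_le_card fun x hx => ?_
        rw [Finset.mem_filter] at hx
        by_contra h
        simp [h] at hx
      · exact card_filter_cons_bag_le (by nlinarith) hbag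
    · have hS : S = R := Finset.Subset.antisymm
        (Finset.sdiff_eq_empty_iff_subset.1 (Finset.not_nonempty_iff_eq_empty.1 hSR)) hRS
      subst hS
      refine ⟨fun _ => [], fun _ _ _ _ _ => Or.inl rfl, fun _ _ => rfl, Or.inl ?_, fun l => ?_⟩
      · exact Finset.card_filter_le _ _
      · exact (Finset.card_filter_le _ _).trans (by nlinarith)
  · -- `R` is split by a balanced separator
    obtain ⟨X, A, B, hX, hs⟩ := hsep R
    have hsub : R ⊆ (R ∩ A ∪ R ∩ B) ∪ X := by
      intro x hx
      have := hs.mem_or x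
      simp only [Finset.mem_union, Finset.mem_inter]; tauto
    have hsum : (R ∩ A).card + (R ∩ B).card ≤ R.card := by
      rw [← Finset.card_union_of_disjoint (Finset.disjoint_of_subset_left Finset.inter_subset_right
        (Finset.disjoint_of_subset_right Finset.inter_subset_right hs.disjoint))]
      exact Finset.card_le_card (Finset.union_subset Finset.inter_subset_left
        Finset.inter_subset_left)
    have hcov : R.card ≤ (R ∩ A).card + (R ∩ B).card + k := by
      have h1 := Finset.card_le_card hsub
      have h2 := Finset.card_union_le (R ∩ A ∪ R ∩ B) X
      have h3 := Finset.card_union_le (R ∩ A) (R ∩ B)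
      omega
    have hcA := hs.card_left
    have hcB := hs.card_right
    have side : ∀ A B : Finset V, (∀ x, x ∈ X ∨ x ∈ A ∨ x ∈ B) → Disjoint X B →
        3 * (R ∩ A).card ≤ 2 * R.card → 3 * (R ∩ B).card ≤ 2 * R.card →
        R.card ≤ (R ∩ A).card + (R ∩ B).card + k →
        ∃ R' : Finset V, ∃ π : V → List ℕ, R'.card ≤ (R ∩ A).card + k ∧
          G.IsTreePartition (S \ B) π ∧ (∀ x ∈ X ∩ S, π x = []) ∧ (∀ x ∈ R \ B, π x = []) ∧
          ((S \ B).filter fun x => π x = []).card + 4 * k ≤ 2 * R'.card ∧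
          ∀ l, ((S \ B).filter fun x => π x = l).card ≤ 24 * k * d := by
      intro A B hmem hXB hA hB hcov
      -- Balance and `|R| > 12k` leave more than `|R|/3 - k > 0` vertices of `R` in `B`, so the
      -- recursion on `S \ B` is on a smaller set.
      have hBpos : 0 < (R ∩ B).card := by omega
      obtain ⟨b, hb⟩ := Finset.card_pos.1 hBpos
      rw [Finset.mem_inter] at hb
      have hle : ((R \ B) ∪ (X ∩ S)).card ≤ (R ∩ A).card + k := by
        refine (Finset.card_le_card (t := (R ∩ A) ∪ X) fun x hx => ?_).trans
          ((Finset.card_union_le _ _).trans (by omega))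
        have := hmem x
        simp only [Finset.mem_union, Finset.mem_inter, Finset.mem_sdiff] at hx ⊢
        tauto
      have hge : R.card ≤ ((R \ B) ∪ (X ∩ S)).card + (R ∩ B).card := by
        rw [← Finset.card_sdiff_add_card_inter R B]
        exact Nat.add_le_add_right (Finset.card_le_card Finset.subset_union_left) _
      obtain ⟨π, h1, h2, h3, h4⟩ := ih (S \ B).card
        (Finset.card_lt_card ⟨Finset.sdiff_subset, fun h =>
          (Finset.mem_sdiff.1 (h (hRS hb.1))).2 hb.2⟩) (S \ B) ((R \ B) ∪ (X ∩ S))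
        (by
          refine Finset.union_subset (Finset.sdiff_subset_sdiff hRS subset_rfl) fun x hx => ?_
          rw [Finset.mem_inter] at hx
          exact Finset.mem_sdiff.2 ⟨hx.2, Finset.disjoint_left.1 hXB hx.1⟩)
        (Finset.card_pos.1 (by omega)) (by omega) rfl
      refine ⟨_, π, hle, h1, fun x hx => h2 x (Finset.mem_union_right _ hx),
        fun x hx => h2 x (Finset.mem_union_left _ hx), ?_, h4⟩
      -- The new root set has at least `|R|/3 > 4k` elements, so both alternatives of the inductive
      -- bound give the slack form.
      omega
    obtain ⟨R₁, π₁, hR₁, hπ₁, hX₁, hroot₁, hr₁, hbag₁⟩ :=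
      side A B hs.mem_or hs.disjoint_right hcA hcB hcov
    obtain ⟨R₂, π₂, hR₂, hπ₂, hX₂, hroot₂, hr₂, hbag₂⟩ :=
      side B A (fun x => by have := hs.mem_or x; tauto) hs.disjoint_left hcB hcA (by omega)
    have hnil := card_filter_glue_nil_le (S := S) hs.disjoint π₁ π₂
    refine ⟨glueAddress B π₁ π₂, hπ₁.glue hs.mem_or hs.not_adj hs.disjoint_left hs.disjoint hπ₂ hX₁ hX₂,
      ?_, Or.inr (by omega), ?_⟩
    · intro x hx
      by_cases h : x ∈ B
      · simp [glueAddress, h, hroot₂ x (Finset.mem_sdiff.2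
          ⟨hx, fun h' => Finset.disjoint_left.1 hs.disjoint h' h⟩)]
      · simp [glueAddress, h, hroot₁ x (Finset.mem_sdiff.2 ⟨hx, h⟩)]
    · rintro (_ | ⟨a, l⟩)
      -- The merged root bag has at most `2|R|` vertices, and `|R| ≤ 12kd`.
      · have : 24 * k * d = 2 * (12 * k * d) := by ring
        omega
      · exact card_filter_glue_le hs.disjoint hbag₁ hbag₂ a l

end TreePartition
end SimpleGraph

namespace SimpleGraph

/-! ### Depth and size of the unit ball. -/

section Ball

variable {V : Type*} [Fintype V] [DecidableEq V] {G : SimpleGraph V} [DecidableRel G.Adj]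

/-- The number of nodes among those at depth `1, …, l.length` on the branch to `l` which lie on the
branch to `m`. -/
noncomputable def commonDepth (l m : List ℕ) : ℝ :=
  ∑ j ∈ Finset.range l.length, if l.drop j <:+ m then 1 else 0

theorem commonDepth_nil (l : List ℕ) : commonDepth l [] = 0 := by
  refine Finset.sum_eq_zero fun j hj => if_neg fun h => ?_
  rw [List.suffix_nil, List.drop_eq_nil_iff] at h
  exact absurd (Finset.mem_range.1 hj) (by omega)

theorem commonDepth_self (l : List ℕ) : commonDepth l l = l.length := by
  rw [commonDepth, Finset.sum_congr rfl fun j _ => if_pos (List.drop_suffix j l)]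
  simp

theorem sum_drop_eq_le_one (l m : List ℕ) :
    (∑ j ∈ Finset.range l.length, if l.drop j = m then (1 : ℝ) else 0) ≤ 1 := by
  rw [Finset.sum_boole]
  norm_cast
  refine Finset.card_le_one.2 fun i hi j hj => ?_
  rw [Finset.mem_filter, Finset.mem_range] at hi hj
  have := congrArg List.length (hi.2.trans hj.2.symm)
  simp only [List.length_drop] at this
  omega

/-- The step from `m` to its child changes the potential by 1 if the child is on the branch to `l`
and by 0 otherwise, so squaring costs nothing. -/
theorem sq_commonDepth_cons_sub_le (l m : List ℕ) (a : ℕ) :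
    (commonDepth l (a :: m) - commonDepth l m) ^ 2 ≤
      ∑ j ∈ Finset.range l.length, if l.drop j = a :: m then (1 : ℝ) else 0 := by
  have h : commonDepth l (a :: m) - commonDepth l m =
      ∑ j ∈ Finset.range l.length, if l.drop j = a :: m then (1 : ℝ) else 0 := by
    rw [commonDepth, commonDepth, ← Finset.sum_sub_distrib]
    refine Finset.sum_congr rfl fun j _ => ?_
    simp only [List.suffix_cons_iff]
    by_cases h1 : l.drop j = a :: m
    · have h2 : ¬ a :: m <:+ m := fun h => by simpa using h.length_le
      simp [h1, h2]
    · simp [h1]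
  rw [h, sq]
  exact mul_le_of_le_one_left (Finset.sum_nonneg fun j _ => by split_ifs <;> norm_num)
    (sum_drop_eq_le_one l _)

theorem IsTreePartition.length_le {π : V → List ℕ} {p d : ℕ}
    (hπ : G.IsTreePartition Finset.univ π)
    (hp : ∀ l, (Finset.univ.filter fun x => π x = l).card ≤ p) (hdeg : ∀ x, G.degree x ≤ d)
    {v u : V} (hv : π v = []) (h : G.effRes v u ≤ 1) : (π u).length ≤ p * d := by
  set K := (π u).length with hK
  -- The indicator that the bag of `x` is a non-root bag on the branch to `u`; edge energies are
  -- charged to it.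
  let g : V → ℝ := fun x => ∑ j ∈ Finset.range K, if (π u).drop j = π x then (1 : ℝ) else 0
  have hg0 : ∀ x, 0 ≤ g x := fun x => Finset.sum_nonneg fun j _ => by split_ifs <;> norm_num
  have hstep : ∀ x y, G.Adj x y →
      (commonDepth (π u) (π x) - commonDepth (π u) (π y)) ^ 2 ≤ g x + g y := by
    intro x y hxy
    rcases hπ x (Finset.mem_univ _) y (Finset.mem_univ _) hxy with e | ⟨a, e⟩ | ⟨a, e⟩
    · rw [e, sub_self]
      simpa using add_nonneg (hg0 x) (hg0 y)
    · have := sq_commonDepth_cons_sub_le (π u) (π y) a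
      rw [← e] at this
      exact this.trans (le_add_of_nonneg_right (hg0 y))
    · have := sq_commonDepth_cons_sub_le (π u) (π x) a
      rw [← e, sub_sq_comm] at this
      exact this.trans (le_add_of_nonneg_left (hg0 x))
  have hgsum : ∑ x, g x ≤ (K * p : ℝ) := by
    rw [Finset.sum_comm]
    refine (Finset.sum_le_card_nsmul _ _ (p : ℝ) fun j _ => ?_).trans_eq (by simp)
    rw [Finset.sum_boole]
    simp only [eq_comm (a := (π u).drop j)]
    exact_mod_cast hp _
  have hrow : ∑ x, ∑ y, (if G.Adj x y then g x else 0) ≤ (K * p * d : ℝ) := by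
    calc ∑ x, ∑ y, (if G.Adj x y then g x else 0) = ∑ x, (G.degree x : ℝ) * g x := by
          refine Finset.sum_congr rfl fun x _ => ?_
          rw [degree_eq_sum_if_adj, Finset.sum_mul]
          simp
      _ ≤ ∑ x, (d : ℝ) * g x := Finset.sum_le_sum fun x _ =>
          mul_le_mul_of_nonneg_right (by exact_mod_cast hdeg x) (hg0 x)
      _ ≤ K * p * d := by
          rw [← Finset.mul_sum, mul_comm]
          exact mul_le_mul_of_nonneg_right hgsum (Nat.cast_nonneg d)
  have hcol : ∑ x, ∑ y, (if G.Adj x y then g y else 0) ≤ (K * p * d : ℝ) := by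
    rw [Finset.sum_comm]
    simpa only [G.adj_comm] using hrow
  have hE := sq_sub_le_of_effRes_le_one h fun x => commonDepth (π u) (π x)
  have hE2 : (∑ x, ∑ y, if G.Adj x y then
      (commonDepth (π u) (π x) - commonDepth (π u) (π y)) ^ 2 else 0) ≤
      ∑ x, ∑ y, (if G.Adj x y then g x else 0) + ∑ x, ∑ y, (if G.Adj x y then g y else 0) := by
    simp only [← Finset.sum_add_distrib]
    refine Finset.sum_le_sum fun x _ => Finset.sum_le_sum fun y _ => ?_
    split_ifs with hxy
    · exact hstep x y hxy
    · simp
  simp only [hv, commonDepth_nil, commonDepth_self, zero_sub, neg_sq, ← hK] at hE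
  have hfin : (K : ℝ) * K ≤ K * (p * d) := by nlinarith
  rcases Nat.eq_zero_or_pos K with h0 | h0
  · omega
  · have := le_of_mul_le_mul_left hfin (by exact_mod_cast h0)
    exact_mod_cast this

open Classical in
/-- The addresses at depth `i` of the vertices in the component of `v`. -/
noncomputable def addressesAt (G : SimpleGraph V) (π : V → List ℕ) (v : V) (i : ℕ) :
    Finset (List ℕ) :=
  (Finset.univ.filter fun x => G.Reachable v x ∧ (π x).length = i).image π

/-- A bag at depth `i + 1` reached from `v` is entered by an edge from its parent bag, and at most
`pd` edges leave that parent. Without reachability a node could have any number of children. -/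
theorem IsTreePartition.card_addressesAt_le {π : V → List ℕ} {p d : ℕ}
    (hπ : G.IsTreePartition Finset.univ π)
    (hp : ∀ l, (Finset.univ.filter fun x => π x = l).card ≤ p) (hdeg : ∀ x, G.degree x ≤ d)
    {v : V} (hv : π v = []) (i : ℕ) : (addressesAt G π v i).card ≤ (p * d) ^ i := by
  induction i with
  | zero =>
    refine (Finset.card_le_card (t := {[]}) fun l hl => ?_).trans (by simp)
    simp only [addressesAt, Finset.mem_image, Finset.mem_filter, List.length_eq_zero_iff] at hl
    obtain ⟨x, ⟨-, -, hx⟩, rfl⟩ := hl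
    simp [hx]
  | succ i ih =>
    have hsub : addressesAt G π v (i + 1) ⊆ (addressesAt G π v i).biUnion fun l =>
        (Finset.univ.filter fun x => π x = l).biUnion fun y => (G.neighborFinset y).image π := by
      intro l hl
      simp only [addressesAt, Finset.mem_image, Finset.mem_filter, Finset.mem_univ,
        true_and] at hl
      obtain ⟨x, ⟨⟨q⟩, hlen⟩, rfl⟩ := hl
      -- The first set is the complement of the subtree rooted at the bag of `x`; the walk must
      -- enter this subtree through its top bag.
      obtain ⟨e, heq, he1, he2⟩ := q.exists_boundary_dart {y | ¬ π x <:+ π y}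
        (by
          simp only [Set.mem_ofPred_eq, hv, List.suffix_nil]
          intro h0; simp [h0] at hlen)
        (by simp)
      simp only [Set.mem_ofPred_eq, not_not] at he1 he2
      have hreach : G.Reachable v e.fst := ⟨q.takeUntil _ (q.dart_fst_mem_support_of_mem_darts heq)⟩
      rcases hπ e.fst (Finset.mem_univ _) e.snd (Finset.mem_univ _) e.adj with h | ⟨a, h⟩ | ⟨a, h⟩
      · exact absurd (h ▸ he2) he1
      · exact absurd (h ▸ he2.trans (List.suffix_cons a _)) he1
      · rw [h, List.suffix_cons_iff] at he2
        have hx := he2.resolve_right he1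
        simp only [Finset.mem_biUnion, addressesAt, Finset.mem_image, Finset.mem_filter,
          Finset.mem_univ, true_and, mem_neighborFinset]
        refine ⟨π e.fst, ⟨e.fst, ⟨hreach, ?_⟩, rfl⟩, e.fst, rfl, e.snd, e.adj, h.trans hx.symm⟩
        rw [hx] at hlen
        simpa using hlen
    refine (Finset.card_le_card hsub).trans ((Finset.card_biUnion_le_card_mul _ _ (p * d)
      fun l _ => ?_).trans ?_)
    · exact (Finset.card_biUnion_le_card_mul _ _ d fun y _ =>
        Finset.card_image_le.trans (hdeg y)).trans (Nat.mul_le_mul_right d (hp l))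
    · rw [pow_succ]; exact Nat.mul_le_mul_right _ ih

theorem IsTreePartition.ncard_erBall_le {π : V → List ℕ} {p d : ℕ}
    (hπ : G.IsTreePartition Finset.univ π)
    (hp : ∀ l, (Finset.univ.filter fun x => π x = l).card ≤ p) (hdeg : ∀ x, G.degree x ≤ d)
    {v : V} (hv : π v = []) (hpd : 1 ≤ p * d) :
    (G.erBall v).ncard ≤ (p * d + 1) * ((p * d) ^ (p * d) * p) := by
  have hsub : G.erBall v ⊆ ((Finset.range (p * d + 1)).biUnion fun i =>
      (addressesAt G π v i).biUnion fun l => Finset.univ.filter fun x => π x = l : Finset V) := by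
    intro u hu
    simp only [Finset.coe_biUnion, Set.mem_iUnion, Finset.mem_coe, Finset.mem_filter,
      Finset.mem_univ, true_and, Finset.mem_range, addressesAt, Finset.mem_image]
    exact ⟨_, Nat.lt_succ_of_le (hπ.length_le hp hdeg hv hu), _,
      ⟨u, ⟨reachable_of_effRes_le_one hu, rfl⟩, rfl⟩, rfl⟩
  refine (Set.ncard_le_ncard hsub (Finset.finite_toSet _)).trans ?_
  rw [Set.ncard_coe_finset]
  refine (Finset.card_biUnion_le_card_mul _ _ ((p * d) ^ (p * d) * p) fun i hi => ?_).trans_eq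
    (by rw [Finset.card_range])
  refine (Finset.card_biUnion_le_card_mul _ _ p fun l _ => hp l).trans (Nat.mul_le_mul_right p ?_)
  exact (hπ.card_addressesAt_le hp hdeg hv i).trans
    (Nat.pow_le_pow_right hpd (by have := Finset.mem_range.1 hi; omega))

/-! ### Edgeless graphs and the final numerical estimate. -/

theorem ncard_erBall_le_one_of_forall_not_adj (h : ∀ x y, ¬ G.Adj x y) (v : V) :
    (G.erBall v).ncard ≤ 1 := by
  refine (Set.ncard_le_ncard (t := {v}) fun u hu => ?_).trans_eq (Set.ncard_singleton v)
  obtain ⟨q⟩ := reachable_of_effRes_le_one hu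
  cases q with
  | nil => rfl
  | cons hadj _ => exact absurd hadj (h _ _)

theorem not_adj_of_treewidth_eq_zero {V : Type*} [Fintype V] {G : SimpleGraph V}
    (h : G.treewidth = 0) (x y : V) : ¬ G.Adj x y := by
  intro hxy
  obtain ⟨n, D, hD⟩ := G.exists_treeDecomposition_card_le_treewidth
  obtain ⟨i, hx, hy⟩ := D.edge_covered x y hxy
  exact hxy.ne (Finset.card_le_one.1 (by simpa [h] using hD i) x hx y hy)

theorem not_adj_of_maxDegree_eq_zero {V : Type*} [Fintype V] {G : SimpleGraph V}
    [DecidableRel G.Adj] (h : G.maxDegree = 0) (x y : V) : ¬ G.Adj x y := by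
  intro hxy
  have h1 := G.degree_le_maxDegree x
  have h2 : 0 < G.degree x := (G.degree_pos_iff_exists_adj x).2 ⟨y, hxy⟩
  omega

theorem numeric_bound {w d : ℕ} (hw : 1 ≤ w) (hd : 1 ≤ d) :
    (24 * (w + 1) * d * d + 1) *
      ((24 * (w + 1) * d * d) ^ (24 * (w + 1) * d * d) * (24 * (w + 1) * d)) ≤
    (max 2 (w * d)) ^ (401 * (w * d ^ 3)) := by
  set m := max 2 (w * d) with hm
  have hm2 : 2 ≤ m := le_max_left _ _
  have hwd : w * d ≤ m := le_max_right _ _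
  set N := 24 * (w + 1) * d * d with hN
  have hw2 : 1 ≤ w * d ^ 3 := Nat.mul_pos hw (pow_pos hd 3)
  have hN1 : N ≤ 48 * (w * d ^ 3) := by
    calc N ≤ 24 * (2 * w) * d * d := by rw [hN]; gcongr; omega
      _ = 48 * (w * d ^ 2) := by ring
      _ ≤ 48 * (w * d ^ 3) := by gcongr; omega
  have hN0 : 1 ≤ N := by rw [hN]; exact Nat.mul_pos (Nat.mul_pos (by omega) hd) hd
  have hp : 24 * (w + 1) * d ≤ N := Nat.le_mul_of_pos_right _ hd
  have hNm : N ≤ m ^ 8 := by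
    calc N ≤ 24 * (2 * w) * d * d := by rw [hN]; gcongr; omega
      _ = 48 * (d * (w * d)) := by ring
      _ ≤ 2 ^ 6 * (w * d * (w * d)) := by
          gcongr
          · norm_num
          · exact Nat.le_mul_of_pos_left d hw
      _ ≤ m ^ 6 * (m * m) := by gcongr
      _ = m ^ 8 := by ring
  have hNm' : N + 1 ≤ m ^ 9 := by
    calc N + 1 ≤ N * 2 := by omega
      _ ≤ m ^ 8 * m := by gcongr
      _ = m ^ 9 := by ring
  calc (N + 1) * (N ^ N * (24 * (w + 1) * d)) ≤ m ^ 9 * ((m ^ 8) ^ N * m ^ 8) := by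
        gcongr; exact hp.trans hNm
    _ = m ^ (17 + 8 * N) := by ring
    -- `17 + 8 · 48 = 401`, using `N ≤ 48wd³` and `1 ≤ wd³`.
    _ ≤ m ^ (401 * (w * d ^ 3)) := Nat.pow_le_pow_right (by omega) (by omega)

theorem erDensity_le (G : SimpleGraph V) [DecidableRel G.Adj] :
    G.erDensity ≤ (max 2 (G.treewidth * G.maxDegree)) ^ (401 * (G.treewidth * G.maxDegree ^ 3)) := by
  refine Finset.sup_le fun v _ => ?_
  -- If the treewidth or the maximum degree is zero, the exponent vanishes and the bound is 1, which
  -- edgeless graphs meet.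
  rcases Nat.eq_zero_or_pos G.treewidth with hw | hw
  · exact (ncard_erBall_le_one_of_forall_not_adj (not_adj_of_treewidth_eq_zero hw) v).trans
      (Nat.one_le_pow _ _ (by omega))
  rcases Nat.eq_zero_or_pos G.maxDegree with hd | hd
  · exact (ncard_erBall_le_one_of_forall_not_adj (not_adj_of_maxDegree_eq_zero hd) v).trans
      (Nat.one_le_pow _ _ (by omega))
  obtain ⟨n, D, hD⟩ := G.exists_treeDecomposition_card_le_treewidth
  obtain ⟨π, hπ, hroot, -, hbag⟩ := exists_isTreePartition_of_separators (G := G)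
    (k := G.treewidth + 1) (by omega) hd G.degree_le_maxDegree
    (fun W => by
      obtain ⟨t, A, B, h⟩ := D.exists_isBalancedSeparation W
      exact ⟨_, A, B, hD t, h⟩)
    Finset.univ {v} (Finset.subset_univ _) (Finset.singleton_nonempty v)
    (by rw [Finset.card_singleton]; exact Nat.mul_pos (by omega) hd)
  exact (hπ.ncard_erBall_le hbag G.degree_le_maxDegree (hroot v (Finset.mem_singleton_self v))
    (Nat.mul_pos (Nat.mul_pos (by omega) hd) hd)).trans (numeric_bound hw hd)

end Ball
end SimpleGraph

theorem mainTheorem4 :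
    (∃ C : ℕ, ∀ (V : Type u) [Fintype V] [DecidableEq V] (G : SimpleGraph V) [DecidableRel G.Adj],
      G.erDensity ≤
        (max 2 (G.treewidth * G.maxDegree)) ^ (C * (G.treewidth * G.maxDegree ^ 3))) ∧
    (∀ d w : ℕ, ∃ K : ℕ, ∀ (V : Type u) [Fintype V] [DecidableEq V] (G : SimpleGraph V)
      [DecidableRel G.Adj], G.maxDegree ≤ d → G.treewidth ≤ w → G.erDensity ≤ K) := by
  refine ⟨⟨401, fun V _ _ G _ => G.erDensity_le⟩, fun d w =>
    ⟨(max 2 (w * d)) ^ (401 * (w * d ^ 3)), fun V _ _ G _ hd hw => G.erDensity_le.trans ?_⟩⟩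
  calc (max 2 (G.treewidth * G.maxDegree)) ^ (401 * (G.treewidth * G.maxDegree ^ 3))
      ≤ (max 2 (w * d)) ^ (401 * (G.treewidth * G.maxDegree ^ 3)) := by gcongr
    _ ≤ (max 2 (w * d)) ^ (401 * (w * d ^ 3)) := by
        refine Nat.pow_le_pow_right (by omega) ?_
        gcongr
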